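/- Let $3\le N\le 9$ and $1\le q<p\le\infty$ with $p>\frac{N}{N-2}$. Let $B_1$ be the open unit ball of $\mathbb{R}^N$. Then there exist a sequence $(f_n)_{n\in\mathbb{N}}$ in $C^\infty(\mathbb{R})$ with $f_n\ge 0$ and $f_n'\ge 0$ on $\mathbb{R}$, and a sequence $(u_n)_{n\in\mathbb{N}}$ of radial functions in $C^\infty(\overline{B_1})$, such that for every $n$ $$-\Delta u_n=f_n(u_n)\ \text{ in } B_1,\qquad u_n=0\ \text{ on }\partial B_1,$$ and $u_n$ has radial Morse index exactly $1$ in $B_1$, and such that $$\frac{\|u_n\|_{L^p(B_1)}}{\|u_n\|_{L^q(B_1)}}\longrightarrow+\infty\quad\text{as } n\to\infty .$$ Here the radial Morse index of $u_n$ in $B_1$ is the maximal dimension of a linear subspace $X$ of $C^1_{c,\mathrm{rad}}(B_1)$, the space of radial $C^1$ functions with compact support in $B_1$, such that $$\int_{B_1}\left(|\nabla\varphi|^2-f_n'(u_n)\,\varphi^2\right)dx<0\qquad\text{for all }\varphi\in X\setminus\{0\}.$$ -/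

import Mathlib

open Set Filter Topology MeasureTheory
open scoped ENNReal ContDiff

noncomputable section

/-- A real function on `ℝ^N` is radial on `S` if its value at a point of `S` depends only on the
Euclidean norm of the point. -/
def IsRadialOn {N : ℕ} (u : EuclideanSpace ℝ (Fin N) → ℝ)
    (S : Set (EuclideanSpace ℝ (Fin N))) : Prop :=
  ∀ x ∈ S, ∀ y ∈ S, ‖x‖ = ‖y‖ → u x = u y

/-- `u ∈ C^∞(closure of B_1)` solves `-Δ u = f(u)` in `B_1`, `u = 0` on `∂B_1`.
On the closed ball (a convex set with interior, hence a set of unique differentiability)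
`ContDiffOn` says that the derivatives of every order exist in the open ball and extend
continuously to the closed ball. In the open ball the Laplacian is the usual one. -/
structure IsSmoothDirichletSolution {N : ℕ} (f : ℝ → ℝ)
    (u : EuclideanSpace ℝ (Fin N) → ℝ) : Prop where
  smooth : ContDiffOn ℝ ∞ u (Metric.closedBall 0 1)
  equation : ∀ x ∈ Metric.ball (0 : EuclideanSpace ℝ (Fin N)) 1,
    -(Laplacian.laplacian u x) = f (u x)
  boundary : ∀ x ∈ Metric.sphere (0 : EuclideanSpace ℝ (Fin N)) 1, u x = 0

/-- The second variation of the energy at `u`: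
`Q_{u,Ω}(φ) = ∫_Ω (|∇φ|² - f'(u) φ²) dx`. -/
def secondVariation {N : ℕ} (f : ℝ → ℝ) (u : EuclideanSpace ℝ (Fin N) → ℝ)
    (Ω : Set (EuclideanSpace ℝ (Fin N))) (φ : EuclideanSpace ℝ (Fin N) → ℝ) : ℝ :=
  ∫ x in Ω, (‖gradient φ x‖ ^ 2 - deriv f (u x) * φ x ^ 2)

/-- The space `C^1_{c,rad}(Ω)` of radial `C^1` functions with compact support in `Ω`, where `Ω` is a
rotation invariant domain; its elements are extended by zero to all of `ℝ^N`. -/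
def radialTestFunctions {N : ℕ} (Ω : Set (EuclideanSpace ℝ (Fin N))) :
    Submodule ℝ (EuclideanSpace ℝ (Fin N) → ℝ) where
  carrier := {φ | ContDiff ℝ 1 φ ∧ HasCompactSupport φ ∧ tsupport φ ⊆ Ω ∧ IsRadialOn φ univ}
  add_mem' := by
    rintro φ ψ ⟨h1, h2, h3, h4⟩ ⟨k1, k2, k3, k4⟩
    refine ⟨h1.add k1, h2.add k2, (tsupport_add φ ψ).trans (union_subset h3 k3), ?_⟩
    intro x hx y hy hxy
    simp only [Pi.add_apply, h4 x hx y hy hxy, k4 x hx y hy hxy]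
  zero_mem' := by
    refine ⟨contDiff_const, HasCompactSupport.zero, ?_, fun _ _ _ _ _ => rfl⟩
    simp [tsupport]
  smul_mem' := by
    rintro c φ ⟨h1, h2, h3, h4⟩
    refine ⟨contDiff_const.smul h1, h2.smul_left (f := fun _ => c),
      (tsupport_smul_subset_right (fun _ => c) φ).trans h3, ?_⟩
    intro x hx y hy hxy
    simp only [Pi.smul_apply, h4 x hx y hy hxy]

/-- `u` has radial Morse index `k` in `Ω`: `k` is the largest dimension of a (finite-dimensional)
subspace `X` of `C^1_{c,rad}(Ω)` such that `Q_{u,Ω}(φ) < 0` for all `φ ∈ X \ {0}`. -/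
def HasRadialMorseIndex {N : ℕ} (f : ℝ → ℝ) (u : EuclideanSpace ℝ (Fin N) → ℝ)
    (Ω : Set (EuclideanSpace ℝ (Fin N))) (k : ℕ) : Prop :=
  IsGreatest {m : ℕ | ∃ X : Submodule ℝ (EuclideanSpace ℝ (Fin N) → ℝ),
    X ≤ radialTestFunctions Ω ∧ FiniteDimensional ℝ X ∧ Module.finrank ℝ X = m ∧
      ∀ φ ∈ X, φ ≠ 0 → secondVariation f u Ω φ < 0} k

/-- The `L^p(B_1)` norm, `1 ≤ p ≤ ∞`, of a function that belongs to `L^p(B_1)`. -/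
def ballNorm {N : ℕ} (u : EuclideanSpace ℝ (Fin N) → ℝ) (p : ℝ≥0∞) : ℝ :=
  (eLpNorm u p (volume.restrict (Metric.ball (0 : EuclideanSpace ℝ (Fin N)) 1))).toReal

end

/-! Write N = k + 3 and U_ε = (ε² + r²)^(-(N-2)/2). The functions u_ε = U_ε - U_ε(1) solve -Δu =
f(u), where f(s) = N(N-2)ε² (s + U_ε(1))^((N+2)/(N-2)) for s ≥ 0, and they concentrate at the origin
as ε → 0.

Index at most 1: dilating the bubble produces Z = (ε² - r²)/(ε² + r²)^(N/2), a radial solution of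
the linearized equation whose only zero is r = ε. Picone's identity on both sides of ε makes the
quadratic form nonnegative on profiles vanishing at ε (`radialForm_nonneg_of_eq_zero`), which is a
single linear condition.

Index at least 1: for U_ε times a cutoff ψ, factoring out U_ε leaves the integral of r^(N-1) U_ε²
(ψ'² - 4Nε²ψ²/(ε² + r²)²). It is negative when the cutoff radius is a large enough multiple of ε
(`radialForm_cutoffBubble_neg`).

Norms: the ball of radius ε alone gives an L^p norm of at least cε^(-a), a = N-2-N/p, while the L^q
norm is at most Cε^(-b) for every b in [0, N-2] with b > N-2-N/q. Since p > q and p > N/(N-2), some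
such b is below a, and the ratio is at least a multiple of ε^(b-a). -/

/-! ### Laplacian of radial functions -/

theorem hasFDerivAt_comp_norm_sq {E : Type*} [NormedAddCommGroup E] [InnerProductSpace ℝ E]
    {G : ℝ → ℝ} {G' : ℝ} {x : E} (h : HasDerivAt G G' (‖x‖ ^ 2)) :
    HasFDerivAt (fun y : E => G (‖y‖ ^ 2)) ((2 * G') • innerSL ℝ x) x := by
  have h2 := h.comp_hasFDerivAt x (hasStrictFDerivAt_norm_sq x).hasFDerivAt
  refine h2.congr_fderiv ?_
  ext v
  simp
  ring

/-- Using the squared radius as variable keeps everything smooth at the origin, so no separate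
argument is needed there. -/
theorem laplacian_comp_norm_sq {N : ℕ} {G G' G'' : ℝ → ℝ}
    (h1 : ∀ t, 0 ≤ t → HasDerivAt G (G' t) t) (h2 : ∀ t, 0 ≤ t → HasDerivAt G' (G'' t) t)
    (x : EuclideanSpace ℝ (Fin N)) :
    Laplacian.laplacian (fun y : EuclideanSpace ℝ (Fin N) => G (‖y‖ ^ 2)) x
      = 4 * ‖x‖ ^ 2 * G'' (‖x‖ ^ 2) + 2 * N * G' (‖x‖ ^ 2) := by
  obtain ⟨B, hB⟩ : ∃ B : EuclideanSpace ℝ (Fin N) →L[ℝ] EuclideanSpace ℝ (Fin N) →L[ℝ] ℝ,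
      ∀ v, B v = innerSL ℝ v := ⟨innerSL ℝ, fun _ => rfl⟩
  have hf : fderiv ℝ (fun y : EuclideanSpace ℝ (Fin N) => G (‖y‖ ^ 2))
      = fun y => (2 * G' (‖y‖ ^ 2)) • B y := by
    ext1 y
    rw [hB]
    exact (hasFDerivAt_comp_norm_sq (h1 _ (sq_nonneg _))).fderiv
  have ha := (hasFDerivAt_comp_norm_sq (h2 _ (sq_nonneg ‖x‖))).const_mul 2
  have hg : fderiv ℝ (fun y : EuclideanSpace ℝ (Fin N) => (2 * G' (‖y‖ ^ 2)) • B y) x = _ :=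
    (ha.smul (B.hasFDerivAt (x := x))).fderiv
  rw [InnerProductSpace.laplacian_eq_iteratedFDeriv_orthonormalBasis _
    (EuclideanSpace.basisFun (Fin N) ℝ)]
  simp only [iteratedFDeriv_two_apply, hf, hg]
  have hx : ‖x‖ ^ 2 = ∑ i, x i ^ 2 := EuclideanSpace.real_norm_sq_eq x
  simp [hB, EuclideanSpace.inner_single_right, Finset.sum_add_distrib]
  have h3 : ∀ i, 2 * (2 * G'' (‖x‖ ^ 2) * x i) * x i = 4 * G'' (‖x‖ ^ 2) * x i ^ 2 := by
    intro i; ring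
  simp only [h3, ← Finset.mul_sum, ← hx]
  ring

/-! ### The bubble and its equation -/

/-- The Aubin–Talenti bubble in dimension `k + 3`, as a function of the squared radius. -/
noncomputable def bubble (k : ℕ) (ε t : ℝ) : ℝ := (ε ^ 2 + t) ^ (-(((k : ℝ) + 1) / 2))

section bubble

variable {k : ℕ} {ε t : ℝ}

theorem bubble_pos (hε : 0 < ε) (ht : 0 ≤ t) : 0 < bubble k ε t :=
  Real.rpow_pos_of_pos (by positivity) _

theorem bubble_sq (hε : 0 < ε) (ht : 0 ≤ t) :
    bubble k ε t ^ 2 = ((ε ^ 2 + t) ^ (k + 1))⁻¹ := by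
  have h : 0 < ε ^ 2 + t := by positivity
  rw [bubble, ← Real.rpow_natCast, ← Real.rpow_mul h.le, ← Real.rpow_natCast (ε ^ 2 + t) (k + 1),
    ← Real.rpow_neg h.le]
  congr 1
  push_cast
  ring

/-- The exponent 4/(N-2) is the critical power minus one; it turns both f(u)/U and f'(u) into
rational functions of r². -/
theorem bubble_rpow (hε : 0 < ε) (ht : 0 ≤ t) :
    bubble k ε t ^ (4 / ((k : ℝ) + 1)) = ((ε ^ 2 + t) ^ 2)⁻¹ := by
  have h : 0 < ε ^ 2 + t := by positivity
  rw [bubble, ← Real.rpow_mul h.le, ← Real.rpow_natCast (ε ^ 2 + t) 2, ← Real.rpow_neg h.le]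
  congr 1
  push_cast
  field_simp
  ring

theorem hasDerivAt_bubble (hε : 0 < ε) (ht : 0 ≤ t) :
    HasDerivAt (bubble k ε) (-(((k : ℝ) + 1) / 2) * (bubble k ε t / (ε ^ 2 + t))) t := by
  have h : 0 < ε ^ 2 + t := by positivity
  have h1 := ((hasDerivAt_id' t).const_add (ε ^ 2)).rpow_const (p := -(((k : ℝ) + 1) / 2))
    (Or.inl h.ne')
  refine h1.congr_deriv ?_
  rw [bubble, Real.rpow_sub_one h.ne']
  ring

theorem antitoneOn_bubble (hε : 0 < ε) : AntitoneOn (bubble k ε) (Ici 0) := by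
  intro s hs t ht hst
  have hs' : 0 ≤ s := hs
  exact Real.rpow_le_rpow_of_nonpos (by positivity) (by linarith) (by
    have : (0 : ℝ) ≤ k := k.cast_nonneg
    linarith)

theorem strictAntiOn_bubble (hε : 0 < ε) : StrictAntiOn (bubble k ε) (Ici 0) := by
  intro s hs t ht hst
  have hs' : 0 ≤ s := hs
  exact Real.rpow_lt_rpow_of_neg (by positivity) (by linarith) (by
    have : (0 : ℝ) ≤ k := k.cast_nonneg
    linarith)

theorem laplacian_bubble (hε : 0 < ε) (c : ℝ) (x : EuclideanSpace ℝ (Fin (k + 3))) :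
    Laplacian.laplacian (fun y : EuclideanSpace ℝ (Fin (k + 3)) => bubble k ε (‖y‖ ^ 2) - c) x
      = -(((k : ℝ) + 3) * (k + 1) * ε ^ 2 *
        (bubble k ε (‖x‖ ^ 2) * ((ε ^ 2 + ‖x‖ ^ 2) ^ 2)⁻¹)) := by
  rw [laplacian_comp_norm_sq (G := fun t => bubble k ε t - c)
    (G' := fun t => -(((k : ℝ) + 1) / 2) * (bubble k ε t / (ε ^ 2 + t)))
    (G'' := fun t => ((k : ℝ) + 1) * (k + 3) / 4 * (bubble k ε t / (ε ^ 2 + t) ^ 2))]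
  · have h : 0 < ε ^ 2 + ‖x‖ ^ 2 := by positivity
    push_cast
    field_simp
    ring
  · intro t ht
    exact (hasDerivAt_bubble hε ht).sub_const c
  · intro t ht
    have h : 0 < ε ^ 2 + t := by positivity
    have h1 := ((hasDerivAt_bubble (k := k) hε ht).div
      ((hasDerivAt_id' t).const_add (ε ^ 2)) h.ne').const_mul (-(((k : ℝ) + 1) / 2))
    refine h1.congr_deriv ?_
    field_simp
    ring

theorem contDiff_bubble_norm_sq (hε : 0 < ε) (c : ℝ) {n : WithTop ℕ∞} :
    ContDiff ℝ n (fun y : EuclideanSpace ℝ (Fin (k + 3)) => bubble k ε (‖y‖ ^ 2) - c) := by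
  refine ContDiff.sub ?_ contDiff_const
  unfold bubble
  refine ContDiff.rpow_const_of_ne (contDiff_const.add (contDiff_norm_sq ℝ)) fun x => ?_
  positivity

end bubble

/-! ### The nonlinearity -/

/-- A smooth nonnegative nondecreasing function on `ℝ`, equal to `a (s + c) ^ κ` for `s > 0`. -/
noncomputable def shiftedPower (a c κ s : ℝ) : ℝ :=
  a * (s + c) ^ κ * Real.smoothTransition (1 + 2 * s / c)

section shiftedPower

variable {a c κ s : ℝ}

theorem smoothTransition_shift_eq_zero (hc : 0 < c) (hs : s ≤ -(c / 2)) :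
    Real.smoothTransition (1 + 2 * s / c) = 0 := by
  apply Real.smoothTransition.zero_of_nonpos
  have : 2 * s / c ≤ -1 := by rw [div_le_iff₀ hc]; linarith
  linarith

theorem shiftedPower_of_nonneg (hc : 0 < c) (hs : 0 ≤ s) :
    shiftedPower a c κ s = a * (s + c) ^ κ := by
  rw [shiftedPower, Real.smoothTransition.one_of_one_le, mul_one]
  have : 0 ≤ 2 * s / c := by positivity
  linarith

theorem shiftedPower_nonneg (ha : 0 ≤ a) (hc : 0 < c) : 0 ≤ shiftedPower a c κ s := by
  rcases le_total s (-(c / 2)) with h | h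
  · rw [shiftedPower, smoothTransition_shift_eq_zero hc h, mul_zero]
  · have h1 : 0 ≤ (s + c) ^ κ := Real.rpow_nonneg (by linarith) _
    have := Real.smoothTransition.nonneg (1 + 2 * s / c)
    unfold shiftedPower
    positivity

theorem monotone_shiftedPower (ha : 0 ≤ a) (hc : 0 < c) (hκ : 0 ≤ κ) :
    Monotone (shiftedPower a c κ) := by
  intro s t hst
  rcases le_total s (-(c / 2)) with h | h
  · rw [shiftedPower, smoothTransition_shift_eq_zero hc h, mul_zero]
    exact shiftedPower_nonneg ha hc
  · have h1 : (s + c) ^ κ ≤ (t + c) ^ κ :=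
      Real.rpow_le_rpow (by linarith) (by linarith) hκ
    have h0 : 0 ≤ (s + c) ^ κ := Real.rpow_nonneg (by linarith) _
    have h2 : Real.smoothTransition (1 + 2 * s / c) ≤ Real.smoothTransition (1 + 2 * t / c) := by
      apply Real.smoothTransition.monotone
      gcongr
    exact mul_le_mul (mul_le_mul_of_nonneg_left h1 ha) h2 (Real.smoothTransition.nonneg _)
      (mul_nonneg ha (h0.trans h1))

/-- The power can be singular only at s = -c, and the transition factor already vanishes for s ≤
-(c/2). -/
theorem contDiff_shiftedPower (hc : 0 < c) : ContDiff ℝ ∞ (shiftedPower a c κ) := by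
  rw [contDiff_iff_contDiffAt]
  intro s
  rcases lt_or_ge s (-(c / 2)) with h | h
  · refine (contDiffAt_const (c := (0 : ℝ))).congr_of_eventuallyEq ?_
    filter_upwards [Iio_mem_nhds h] with t ht
    rw [shiftedPower, smoothTransition_shift_eq_zero hc (le_of_lt ht), mul_zero]
  · unfold shiftedPower
    refine ContDiffAt.mul (contDiffAt_const.mul ?_) ?_
    · exact (contDiffAt_id.add contDiffAt_const).rpow_const_of_ne (by simp only [id]; linarith)
    · exact Real.smoothTransition.contDiff.contDiffAt.comp s
        (contDiffAt_const.add ((contDiffAt_const.mul contDiffAt_id).div_const c))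

theorem deriv_shiftedPower_nonneg (ha : 0 ≤ a) (hc : 0 < c) (hκ : 0 ≤ κ) :
    0 ≤ deriv (shiftedPower a c κ) s :=
  (monotone_shiftedPower ha hc hκ).deriv_nonneg

theorem deriv_shiftedPower_of_pos (hc : 0 < c) (hs : 0 < s) :
    deriv (shiftedPower a c κ) s = a * κ * (s + c) ^ (κ - 1) := by
  have h : shiftedPower a c κ =ᶠ[𝓝 s] fun t => a * (t + c) ^ κ := by
    filter_upwards [Ioi_mem_nhds hs] with t ht
    exact shiftedPower_of_nonneg hc (le_of_lt ht)
  rw [h.deriv_eq]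
  have h1 := (((hasDerivAt_id' s).add_const c).rpow_const (p := κ)
    (Or.inl (by linarith))).const_mul a
  rw [h1.deriv]
  ring

end shiftedPower

/-- The nonlinearity `f` with `-Δ u = f(u)` for the bubble minus its boundary value. -/
noncomputable def bubbleNonlinearity (k : ℕ) (ε : ℝ) : ℝ → ℝ :=
  shiftedPower (((k : ℝ) + 3) * (k + 1) * ε ^ 2) (bubble k ε 1) (((k : ℝ) + 5) / (k + 1))

/-- The bubble minus its boundary value. -/
noncomputable def bubbleSolution (k : ℕ) (ε : ℝ) (x : EuclideanSpace ℝ (Fin (k + 3))) : ℝ :=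
  bubble k ε (‖x‖ ^ 2) - bubble k ε 1

theorem isSmoothDirichletSolution_bubble {k : ℕ} {ε : ℝ} (hε : 0 < ε) :
    IsSmoothDirichletSolution (bubbleNonlinearity k ε) (bubbleSolution k ε) where
  smooth := (contDiff_bubble_norm_sq hε _).contDiffOn
  equation x hx := by
    have hx1 : ‖x‖ < 1 := by simpa using hx
    have hp := bubble_pos (k := k) hε (sq_nonneg ‖x‖)
    have hk : (k : ℝ) + 1 ≠ 0 := by positivity
    unfold bubbleSolution
    rw [laplacian_bubble hε, bubbleNonlinearity, shiftedPower_of_nonneg (bubble_pos hε zero_le_one),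
      neg_neg, sub_add_cancel, ← bubble_rpow hε (sq_nonneg _)]
    · have : ((k : ℝ) + 5) / (k + 1) = 1 + 4 / (k + 1) := by field_simp; ring
      rw [this, Real.rpow_add hp, Real.rpow_one]
    · rw [sub_nonneg]
      exact antitoneOn_bubble hε (sq_nonneg ‖x‖) (mem_Ici.2 zero_le_one) (by nlinarith [norm_nonneg x])
  boundary x hx := by
    have hx1 : ‖x‖ = 1 := by simpa using hx
    simp [bubbleSolution, hx1]

theorem deriv_bubbleNonlinearity {k : ℕ} {ε : ℝ} (hε : 0 < ε) {x : EuclideanSpace ℝ (Fin (k + 3))}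
    (hx : ‖x‖ < 1) :
    deriv (bubbleNonlinearity k ε) (bubbleSolution k ε x)
      = ((k : ℝ) + 3) * (k + 5) * ε ^ 2 / (ε ^ 2 + ‖x‖ ^ 2) ^ 2 := by
  have hk : (k : ℝ) + 1 ≠ 0 := by positivity
  rw [bubbleNonlinearity, bubbleSolution, deriv_shiftedPower_of_pos (bubble_pos hε zero_le_one),
    sub_add_cancel]
  · have : ((k : ℝ) + 5) / (k + 1) - 1 = 4 / (k + 1) := by field_simp; ring
    rw [this, bubble_rpow hε (sq_nonneg _)]
    field_simp
  · rw [sub_pos]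
    exact strictAntiOn_bubble hε (sq_nonneg ‖x‖) (mem_Ici.2 zero_le_one) (by nlinarith [norm_nonneg x])

/-! ### Reduction to one-dimensional integrals -/

/-- The restriction of `φ` to the first coordinate axis. -/
noncomputable def radialProfile {k : ℕ} (φ : EuclideanSpace ℝ (Fin (k + 3)) → ℝ) (r : ℝ) : ℝ :=
  φ (r • EuclideanSpace.single 0 1)

section radial

variable {k : ℕ} {φ : EuclideanSpace ℝ (Fin (k + 3)) → ℝ}

theorem IsRadialOn.eq_radialProfile (h : IsRadialOn φ univ) (x : EuclideanSpace ℝ (Fin (k + 3))) :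
    φ x = radialProfile φ ‖x‖ :=
  h x (mem_univ _) _ (mem_univ _) (by simp [norm_smul])

theorem ContDiff.radialProfile (h : ContDiff ℝ 1 φ) : ContDiff ℝ 1 (radialProfile φ) :=
  h.comp (contDiff_id.smul contDiff_const)

theorem IsRadialOn.norm_gradient (h : IsRadialOn φ univ) (hφ : ContDiff ℝ 1 φ)
    {x : EuclideanSpace ℝ (Fin (k + 3))} (hx : x ≠ 0) :
    ‖gradient φ x‖ ^ 2 = deriv (radialProfile φ) ‖x‖ ^ 2 := by
  have h1 : φ = fun y => radialProfile φ ‖y‖ := funext h.eq_radialProfile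
  have h2 : HasDerivAt (radialProfile φ) (deriv (radialProfile φ) ‖x‖) ‖x‖ :=
    (hφ.radialProfile.differentiable one_ne_zero _).hasDerivAt
  have h4 : DifferentiableAt ℝ (fun y : EuclideanSpace ℝ (Fin (k + 3)) => ‖y‖) x :=
    differentiableAt_id.norm ℝ hx
  have h3 := h2.comp_hasFDerivAt x h4.hasFDerivAt
  have h5 : fderiv ℝ φ x = deriv (radialProfile φ) ‖x‖ •
      fderiv ℝ (fun y : EuclideanSpace ℝ (Fin (k + 3)) => ‖y‖) x := by
    conv_lhs => rw [h1]
    exact h3.fderiv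
  rw [gradient, LinearIsometryEquiv.norm_map, h5, norm_smul, norm_fderiv_norm h4, mul_one,
    Real.norm_eq_abs, sq_abs]

theorem setIntegral_ball_comp_norm (F : ℝ → ℝ) :
    ∫ x in Metric.ball (0 : EuclideanSpace ℝ (Fin (k + 3))) 1, F ‖x‖
      = ((k : ℝ) + 3) * volume.real (Metric.ball (0 : EuclideanSpace ℝ (Fin (k + 3))) 1) *
        ∫ r in (0 : ℝ)..1, r ^ (k + 2) * F r := by
  have h1 : ∀ x : EuclideanSpace ℝ (Fin (k + 3)),
      (Metric.ball (0 : EuclideanSpace ℝ (Fin (k + 3))) 1).indicator (fun x => F ‖x‖) x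
        = (Iio (1 : ℝ)).indicator F ‖x‖ := by
    intro x
    simp [indicator]
  rw [← integral_indicator measurableSet_ball, funext h1, integral_fun_norm_addHaar,
    intervalIntegral.integral_of_le zero_le_one, integral_Ioc_eq_integral_Ioo, finrank_euclideanSpace,
    Fintype.card_fin]
  have h2 : ∀ r : ℝ, r ^ (k + 3 - 1) • (Iio (1 : ℝ)).indicator F r
      = (Iio (1 : ℝ)).indicator (fun r => r ^ (k + 2) * F r) r := by
    intro r
    by_cases hr : r < 1 <;> simp [hr]
  simp only [h2]
  rw [setIntegral_indicator measurableSet_Iio, Ioi_inter_Iio]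
  simp
  ring

/-- Polar coordinates; the origin, where the norm is not differentiable, is a null set. -/
theorem secondVariation_eq_radial {f : ℝ → ℝ} {u : EuclideanSpace ℝ (Fin (k + 3)) → ℝ} {V : ℝ → ℝ}
    (hV : ∀ x ∈ Metric.ball (0 : EuclideanSpace ℝ (Fin (k + 3))) 1, deriv f (u x) = V ‖x‖)
    (h : IsRadialOn φ univ) (hφ : ContDiff ℝ 1 φ) :
    secondVariation f u (Metric.ball 0 1) φ
      = ((k : ℝ) + 3) * volume.real (Metric.ball (0 : EuclideanSpace ℝ (Fin (k + 3))) 1) *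
        ∫ r in (0 : ℝ)..1, r ^ (k + 2) *
          (deriv (radialProfile φ) r ^ 2 - V r * radialProfile φ r ^ 2) := by
  rw [← setIntegral_ball_comp_norm
    fun r => deriv (radialProfile φ) r ^ 2 - V r * radialProfile φ r ^ 2, secondVariation]
  refine setIntegral_congr_ae measurableSet_ball ?_
  have h0 : ∀ᵐ x : EuclideanSpace ℝ (Fin (k + 3)), x ≠ 0 := by
    simp [ae_iff]
  filter_upwards [h0] with x hx hxb
  rw [h.norm_gradient hφ hx, hV x hxb, ← h.eq_radialProfile]

end radial

/-! ### Nonnegativity of the form on profiles vanishing at ε -/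

/-- The potential `f'(u)` of the linearized equation at the bubble, as a function of the radius. -/
noncomputable def bubblePotential (k : ℕ) (ε r : ℝ) : ℝ :=
  ((k : ℝ) + 3) * (k + 5) * ε ^ 2 / (ε ^ 2 + r ^ 2) ^ 2

section quadraticForm

variable {k : ℕ} {ε : ℝ} {g : ℝ → ℝ}

theorem continuous_radialIntegrand (hε : 0 < ε) (hg : ContDiff ℝ 1 g) :
    Continuous fun r => r ^ (k + 2) * (deriv g r ^ 2 - bubblePotential k ε r * g r ^ 2) := by
  have h1 := hg.continuous_deriv le_rfl
  have h2 := hg.continuous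
  unfold bubblePotential
  have h3 : ∀ r : ℝ, (ε ^ 2 + r ^ 2) ^ 2 ≠ 0 := fun r => by positivity
  fun_prop (disch := exact h3 _)

/-- Picone's identity with the radial kernel element `(ε² - r²) / (ε² + r²) ^ (N / 2)` of the
linearized operator. -/
theorem radialForm_nonneg_of_eq_zero (hε : 0 < ε) (hε1 : ε < 1) (hg : ContDiff ℝ 1 g)
    (h0 : g ε = 0) (h1 : g 1 = 0) :
    0 ≤ ∫ r in (0 : ℝ)..1, r ^ (k + 2) * (deriv g r ^ 2 - bubblePotential k ε r * g r ^ 2) := by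
  set F : ℝ → ℝ := fun r => r ^ (k + 2) * (deriv g r ^ 2 - bubblePotential k ε r * g r ^ 2) with hF
  have hFc : Continuous F := continuous_radialIntegrand hε hg
  -- This is W = r^(N-1) g² Z'/Z, for which F - W' = r^(N-1) (g' - g Z'/Z)² ≥ 0 away from ε.
  set W : ℝ → ℝ := fun r => -r ^ (k + 3) *
    (2 * g r ^ 2 / (ε ^ 2 - r ^ 2) + (k + 3) * g r ^ 2 / (ε ^ 2 + r ^ 2)) with hW
  have hgd : ∀ r, HasDerivAt g (deriv g r) r := fun r =>
    (hg.differentiable one_ne_zero r).hasDerivAt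
  have hds : Continuous (dslope g ε) := by
    rw [← continuousOn_univ, continuousOn_dslope univ_mem]
    exact ⟨hg.continuous.continuousOn, (hgd ε).differentiableAt⟩
  have hWc : ContinuousOn W (Ici 0) := by
    -- Since g(ε) = 0, one factor g is divided by r - ε, which removes the pole of W. The limit at ε
    -- is 0, and so is the value of W there under division by zero.
    have h2 : ContinuousOn (fun r => -r ^ (k + 3) *
        (2 * (-(g r * dslope g ε r)) / (ε + r) + (k + 3) * g r ^ 2 / (ε ^ 2 + r ^ 2))) (Ici 0) := by
      have hgc := hg.continuous.continuousOn (s := Ici 0)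
      have hdc := hds.continuousOn (s := Ici 0)
      refine ContinuousOn.mul (by fun_prop) (ContinuousOn.add (ContinuousOn.div (by fun_prop)
        (by fun_prop) fun r hr => ?_) (ContinuousOn.div (by fun_prop) (by fun_prop) fun r hr => ?_))
      · have : 0 ≤ r := hr
        positivity
      · positivity
    refine h2.congr fun r hr => ?_
    have hr0 : 0 ≤ r := hr
    simp only [hW]
    congr 2
    rcases eq_or_ne r ε with rfl | hne
    · simp [h0]
    · rw [dslope_of_ne _ hne, slope_def_field, h0]
      have a1 : ε ^ 2 - r ^ 2 ≠ 0 := by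
        intro h
        have : (ε - r) * (ε + r) = 0 := by linarith
        rcases mul_eq_zero.1 this with h | h
        · exact hne (by linarith)
        · linarith
      have a2 : r - ε ≠ 0 := sub_ne_zero.2 hne
      have a3 : ε + r ≠ 0 := by positivity
      field_simp
      ring
  have hWd : ∀ r, 0 < r → r ≠ ε → ∃ W', HasDerivAt W W' r ∧ W' ≤ F r := by
    intro r hr hne
    have a1 : ε ^ 2 - r ^ 2 ≠ 0 := by
      intro h
      have : (ε - r) * (ε + r) = 0 := by linarith
      rcases mul_eq_zero.1 this with h | h
      · exact hne (by linarith)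
      · linarith
    have a2 : ε ^ 2 + r ^ 2 ≠ 0 := by positivity
    have b1 := ((hgd r).pow 2).const_mul 2 |>.div ((hasDerivAt_pow 2 r).const_sub (ε ^ 2)) a1
    have b2 := ((hgd r).pow 2).const_mul ((k : ℝ) + 3) |>.div
      ((hasDerivAt_pow 2 r).const_add (ε ^ 2)) a2
    have b3 := (hasDerivAt_pow (k + 3) r).neg.mul (b1.add b2)
    refine ⟨_, b3, ?_⟩
    rw [← sub_nonneg]
    have b4 : 0 ≤ r ^ (k + 2) * (deriv g r
        + (2 * r / (ε ^ 2 - r ^ 2) + (k + 3) * r / (ε ^ 2 + r ^ 2)) * g r) ^ 2 := by positivity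
    refine b4.trans_eq ?_
    simp only [hF, bubblePotential, Pi.add_apply, Pi.div_apply, Pi.pow_apply, Pi.neg_apply]
    push_cast
    field_simp
    ring
  choose! W' hW' using hWd
  have i1 : W ε - W 0 ≤ ∫ r in (0 : ℝ)..ε, F r :=
    intervalIntegral.sub_le_integral_of_hasDeriv_right_of_le hε.le (hWc.mono Icc_subset_Ici_self)
      (fun r hr => (hW' r hr.1 hr.2.ne).1.hasDerivWithinAt) hFc.continuousOn.integrableOn_Icc
      (fun r hr => (hW' r hr.1 hr.2.ne).2)
  have i2 : W 1 - W ε ≤ ∫ r in ε..1, F r :=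
    intervalIntegral.sub_le_integral_of_hasDeriv_right_of_le hε1.le
      (hWc.mono (Icc_subset_Ici_self.trans (Ici_subset_Ici.2 hε.le)))
      (fun r hr => (hW' r (hε.trans hr.1) hr.1.ne').1.hasDerivWithinAt)
      hFc.continuousOn.integrableOn_Icc (fun r hr => (hW' r (hε.trans hr.1) hr.1.ne').2)
  have i3 := intervalIntegral.integral_add_adjacent_intervals
    (hFc.intervalIntegrable 0 ε) (hFc.intervalIntegrable ε 1) (μ := volume)
  have i4 : W 0 = 0 := by simp [hW]
  have i5 : W 1 = 0 := by simp [hW, h1]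
  linarith

end quadraticForm

/-! ### The cut-off bubble as a negative direction -/

theorem hasDerivAt_max_zero_sq (t : ℝ) : HasDerivAt (fun s : ℝ => max s 0 ^ 2) (2 * max t 0) t := by
  rcases lt_trichotomy t 0 with h | rfl | h
  · rw [max_eq_right h.le, mul_zero]
    refine (hasDerivAt_const t (0 : ℝ)).congr_of_eventuallyEq ?_
    filter_upwards [Iio_mem_nhds h] with s hs
    simp [max_eq_right (le_of_lt (mem_Iio.1 hs))]
  · simp only [max_self, mul_zero]
    have : (fun s : ℝ => max s 0 ^ 2) =O[𝓝 0] fun s => ‖s - 0‖ ^ 2 := by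
      refine Asymptotics.IsBigO.of_bound 1 (Eventually.of_forall fun s => ?_)
      rcases le_total s 0 with h | h <;> simp [h]
      positivity
    simpa using (this.hasFDerivAt one_lt_two).hasDerivAt
  · rw [max_eq_left h.le]
    have h1 := (hasDerivAt_pow 2 t)
    refine (h1.congr_deriv (by simp)).congr_of_eventuallyEq ?_
    filter_upwards [Ioi_mem_nhds h] with s hs
    simp [max_eq_left (le_of_lt (mem_Ioi.1 hs))]

theorem contDiff_max_zero_sq : ContDiff ℝ 1 fun s : ℝ => max s 0 ^ 2 := by
  rw [contDiff_one_iff_deriv]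
  refine ⟨fun t => (hasDerivAt_max_zero_sq t).differentiableAt, ?_⟩
  rw [funext fun t => (hasDerivAt_max_zero_sq t).deriv]
  fun_prop

/-- The bubble times the squared positive part of `1 - r² / ρ²`, as a function of `t = r²`. -/
noncomputable def cutoffBubble (k : ℕ) (ε ρ t : ℝ) : ℝ :=
  bubble k ε t * max (1 - t / ρ ^ 2) 0 ^ 2

section cutoffBubble

variable {k : ℕ} {ε ρ : ℝ}

/-- A general E covers both the test function on ℝ^N and its profile on ℝ. -/
theorem contDiff_cutoffBubble {E : Type*} [NormedAddCommGroup E] [InnerProductSpace ℝ E]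
    (hε : 0 < ε) : ContDiff ℝ 1 fun x : E => cutoffBubble k ε ρ (‖x‖ ^ 2) := by
  unfold cutoffBubble
  refine ContDiff.mul ?_ (contDiff_max_zero_sq.comp
    (contDiff_const.sub ((contDiff_norm_sq ℝ).div_const _)))
  unfold bubble
  refine ContDiff.rpow_const_of_ne (contDiff_const.add (contDiff_norm_sq ℝ)) fun x => ?_
  positivity

theorem hasDerivAt_bubble_sq (hε : 0 < ε) (r : ℝ) :
    HasDerivAt (fun r => bubble k ε (r ^ 2))
      (-((k : ℝ) + 1) * r * bubble k ε (r ^ 2) / (ε ^ 2 + r ^ 2)) r := by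
  have h1 := HasDerivAt.comp (h := fun r : ℝ => r ^ 2) r
    (hasDerivAt_bubble (k := k) hε (sq_nonneg r)) (hasDerivAt_pow 2 r)
  refine h1.congr_deriv ?_
  have : ε ^ 2 + r ^ 2 ≠ 0 := by positivity
  field_simp
  norm_num
  ring

theorem hasDerivAt_cutoff (r : ℝ) :
    HasDerivAt (fun r => max (1 - r ^ 2 / ρ ^ 2) 0 ^ 2)
      (-4 * r / ρ ^ 2 * max (1 - r ^ 2 / ρ ^ 2) 0) r := by
  have h1 := (hasDerivAt_max_zero_sq (1 - r ^ 2 / ρ ^ 2)).comp r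
    (((hasDerivAt_pow 2 r).div_const (ρ ^ 2)).const_sub 1)
  refine h1.congr_deriv ?_
  norm_num
  ring

/-- Both rε and r² are at most ε² + r²; use the first k times and the second once. -/
theorem pow_mul_bubble_sq_le (hε : 0 < ε) {r : ℝ} (hr : 0 ≤ r) :
    r ^ (k + 2) * bubble k ε (r ^ 2) ^ 2 ≤ (ε ^ k)⁻¹ := by
  rw [bubble_sq hε (sq_nonneg r), ← div_eq_mul_inv, ← one_div,
    div_le_div_iff₀ (by positivity) (by positivity), one_mul]
  have h1 : (r * ε) ^ k ≤ (ε ^ 2 + r ^ 2) ^ k :=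
    pow_le_pow_left₀ (by positivity) (by nlinarith [sq_nonneg (r - ε), mul_pos hε hε]) k
  calc r ^ (k + 2) * ε ^ k = (r * ε) ^ k * r ^ 2 := by ring
    _ ≤ (ε ^ 2 + r ^ 2) ^ k * (ε ^ 2 + r ^ 2) := by
        refine mul_le_mul h1 ?_ (by positivity) (by positivity)
        nlinarith [mul_pos hε hε]
    _ = (ε ^ 2 + r ^ 2) ^ (k + 1) := by ring

/-- The boundary term arising when the bubble is factored out of the radial quadratic form. -/
theorem hasDerivAt_boundaryTerm (hε : 0 < ε) {ψ : ℝ → ℝ} {ψ' r : ℝ} (hψ : HasDerivAt ψ ψ' r) :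
    HasDerivAt (fun r => -((k : ℝ) + 1) * r ^ (k + 3) *
        (bubble k ε (r ^ 2) * ψ r) ^ 2 / (ε ^ 2 + r ^ 2))
      (r ^ (k + 2) * (((-((k : ℝ) + 1) * r * bubble k ε (r ^ 2) / (ε ^ 2 + r ^ 2)) * ψ r
          + bubble k ε (r ^ 2) * ψ') ^ 2
          - bubblePotential k ε r * (bubble k ε (r ^ 2) * ψ r) ^ 2)
        - r ^ (k + 2) * bubble k ε (r ^ 2) ^ 2 *
          (ψ' ^ 2 - 4 * ((k : ℝ) + 3) * ε ^ 2 / (ε ^ 2 + r ^ 2) ^ 2 * ψ r ^ 2)) r := by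
  have h0 : ε ^ 2 + r ^ 2 ≠ 0 := by positivity
  have h1 := (((hasDerivAt_pow (k + 3) r).const_mul (-((k : ℝ) + 1))).mul
    (((hasDerivAt_bubble_sq (k := k) hε r).mul hψ).pow 2)).div
    ((hasDerivAt_pow 2 r).const_add (ε ^ 2)) h0
  refine h1.congr_deriv ?_
  simp only [bubblePotential, Pi.mul_apply, Pi.pow_apply]
  push_cast
  field_simp
  ring

/-- The boundary term T vanishes at 0 and ρ, so the form equals the integral of D. The gradient part
is bounded on all of [0, ρ], and the negative part is kept only on [0, ε]. -/
theorem radialForm_cutoffBubble_neg (hε : 0 < ε) (hρ : ρ = 2 ^ (k + 5) * ε) (hρ1 : ρ < 1)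
    {g : ℝ → ℝ} (hg : g = fun r => cutoffBubble k ε ρ (r ^ 2)) :
    ∫ r in (0 : ℝ)..1, r ^ (k + 2) * (deriv g r ^ 2 - bubblePotential k ε r * g r ^ 2) < 0 := by
  have hερ : 32 * ε ≤ ρ := by
    have : (1 : ℝ) ≤ 2 ^ k := one_le_pow₀ one_le_two
    rw [hρ, pow_add]
    nlinarith
  have hρ0 : 0 < ρ := by linarith
  have hgC : ContDiff ℝ 1 g := by
    have := contDiff_cutoffBubble (k := k) (ε := ε) (ρ := ρ) (E := ℝ) hε
    simpa [hg] using this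
  set F : ℝ → ℝ := fun r => r ^ (k + 2) * (deriv g r ^ 2 - bubblePotential k ε r * g r ^ 2) with hF
  have hFc : Continuous F := continuous_radialIntegrand hε hgC
  set ψ : ℝ → ℝ := fun r => max (1 - r ^ 2 / ρ ^ 2) 0 ^ 2 with hψ
  set ψ' : ℝ → ℝ := fun r => -4 * r / ρ ^ 2 * max (1 - r ^ 2 / ρ ^ 2) 0 with hψ'
  have hψd : ∀ r, HasDerivAt ψ (ψ' r) r := fun r => hasDerivAt_cutoff r
  have hgd : ∀ r, deriv g r = (-((k : ℝ) + 1) * r * bubble k ε (r ^ 2) / (ε ^ 2 + r ^ 2)) * ψ r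
          + bubble k ε (r ^ 2) * ψ' r := by
    intro r
    rw [hg]
    exact ((hasDerivAt_bubble_sq hε r).mul (hψd r)).deriv
  have hgr : ∀ r, g r = bubble k ε (r ^ 2) * ψ r := fun r => by rw [hg]; rfl
  set T : ℝ → ℝ := fun r => -((k : ℝ) + 1) * r ^ (k + 3) *
        (bubble k ε (r ^ 2) * ψ r) ^ 2 / (ε ^ 2 + r ^ 2) with hT
  set D : ℝ → ℝ := fun r => r ^ (k + 2) * bubble k ε (r ^ 2) ^ 2 *
          (ψ' r ^ 2 - 4 * ((k : ℝ) + 3) * ε ^ 2 / (ε ^ 2 + r ^ 2) ^ 2 * ψ r ^ 2) with hD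
  have hTd : ∀ r, HasDerivAt T (F r - D r) r := by
    intro r
    refine (hasDerivAt_boundaryTerm (k := k) hε (hψd r)).congr_deriv ?_
    simp only [hF, hD, hgd r, hgr]
  have hTc : Continuous T := continuous_iff_continuousAt.2 fun r => (hTd r).continuousAt
  -- A collects |ψ'|² ≤ 16r²/ρ⁴ and r^(N-1) U² ≤ ε^(-k). B bounds the negative part for r ≤ ε, where
  -- ε² + r² ≤ 2ε² and ψ² ≥ 1/2.
  set A : ℝ := 16 / (ρ ^ 4 * ε ^ k) with hA
  set B : ℝ := ((k : ℝ) + 3) / (2 * ε ^ 2) * ((2 * ε ^ 2) ^ (k + 1))⁻¹ with hB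
  have hgrad : ∀ r, 0 ≤ r → r ^ (k + 2) * bubble k ε (r ^ 2) ^ 2 * ψ' r ^ 2 ≤ A * r ^ 2 := by
    intro r hr
    have h1 : max (1 - r ^ 2 / ρ ^ 2) 0 ≤ 1 := by
      have : 0 ≤ r ^ 2 / ρ ^ 2 := by positivity
      exact max_le (by linarith) zero_le_one
    have h2 : max (1 - r ^ 2 / ρ ^ 2) 0 ^ 2 ≤ 1 := pow_le_one₀ (le_max_right _ _) h1
    have h3 : ψ' r ^ 2 ≤ 16 * r ^ 2 / ρ ^ 4 := by
      calc ψ' r ^ 2 = 16 * r ^ 2 / ρ ^ 4 * max (1 - r ^ 2 / ρ ^ 2) 0 ^ 2 := by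
            simp only [hψ']; ring
        _ ≤ 16 * r ^ 2 / ρ ^ 4 := mul_le_of_le_one_right (by positivity) h2
    calc r ^ (k + 2) * bubble k ε (r ^ 2) ^ 2 * ψ' r ^ 2
        ≤ (ε ^ k)⁻¹ * (16 * r ^ 2 / ρ ^ 4) :=
          mul_le_mul (pow_mul_bubble_sq_le hε hr) h3 (sq_nonneg _) (by positivity)
      _ = A * r ^ 2 := by rw [hA]; field_simp
  have hD2 : ∀ r, 0 ≤ r → D r ≤ A * r ^ 2 := by
    intro r hr
    have h1 : 0 ≤ r ^ (k + 2) * bubble k ε (r ^ 2) ^ 2 *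
        (4 * ((k : ℝ) + 3) * ε ^ 2 / (ε ^ 2 + r ^ 2) ^ 2 * ψ r ^ 2) := by positivity
    have := hgrad r hr
    simp only [hD, mul_sub]
    linarith
  have hD1 : ∀ r, 0 ≤ r → r ≤ ε → D r ≤ A * r ^ 2 - B * r ^ (k + 2) := by
    intro r hr hrε
    have h1 : r ^ 2 ≤ ε ^ 2 := pow_le_pow_left₀ hr hrε 2
    have h2 : ((2 * ε ^ 2) ^ (k + 1))⁻¹ ≤ bubble k ε (r ^ 2) ^ 2 := by
      rw [bubble_sq hε (sq_nonneg r)]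
      gcongr
      linarith
    have h3 : 1 / (4 * ε ^ 2) ≤ ε ^ 2 / (ε ^ 2 + r ^ 2) ^ 2 := by
      rw [div_le_div_iff₀ (by positivity) (by positivity)]
      nlinarith [sq_nonneg r]
    have h4 : 1 / 2 ≤ ψ r ^ 2 := by
      have h5 : r ^ 2 / ρ ^ 2 ≤ 1 / 8 := by
        rw [div_le_div_iff₀ (by positivity) (by norm_num)]
        nlinarith
      have h6 : 7 / 8 ≤ max (1 - r ^ 2 / ρ ^ 2) 0 := le_max_of_le_left (by linarith)
      calc (1 : ℝ) / 2 ≤ ((7 / 8) ^ 2) ^ 2 := by norm_num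
        _ ≤ ψ r ^ 2 := by simp only [hψ]; gcongr
    have h7 : B * r ^ (k + 2) ≤ r ^ (k + 2) * bubble k ε (r ^ 2) ^ 2 *
        (4 * ((k : ℝ) + 3) * ε ^ 2 / (ε ^ 2 + r ^ 2) ^ 2 * ψ r ^ 2) := by
      calc B * r ^ (k + 2) = r ^ (k + 2) * ((2 * ε ^ 2) ^ (k + 1))⁻¹ *
            (4 * ((k : ℝ) + 3) * (1 / (4 * ε ^ 2)) * (1 / 2)) := by
              rw [hB]; field_simp
        _ ≤ r ^ (k + 2) * bubble k ε (r ^ 2) ^ 2 *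
            (4 * ((k : ℝ) + 3) * (ε ^ 2 / (ε ^ 2 + r ^ 2) ^ 2) * ψ r ^ 2) := by gcongr
        _ = _ := by rw [mul_div_assoc]
    have := hgrad r hr
    simp only [hD, mul_sub]
    linarith
  have i1 : ∫ r in (0 : ℝ)..ε, F r ≤
      (T ε + A * ε ^ 3 / 3 - B * ε ^ (k + 3) / (k + 3)) - 0 := by
    have e0 : (0 : ℝ) = T 0 + A * 0 ^ 3 / 3 - B * 0 ^ (k + 3) / (k + 3) := by simp [hT]
    nth_rewrite 2 [e0]
    refine intervalIntegral.integral_le_sub_of_hasDeriv_right_of_le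
      (g := fun r => T r + A * r ^ 3 / 3 - B * r ^ (k + 3) / (k + 3))
      (g' := fun r => F r - D r + A * r ^ 2 - B * r ^ (k + 2)) hε.le (by fun_prop)
      (fun r hr => HasDerivAt.hasDerivWithinAt ?_) hFc.continuousOn.integrableOn_Icc
      (fun r hr => ?_)
    · refine (((hTd r).add (((hasDerivAt_pow 3 r).const_mul A).div_const 3)).sub
        (((hasDerivAt_pow (k + 3) r).const_mul B).div_const ((k : ℝ) + 3))).congr_deriv ?_
      have : (k : ℝ) + 3 ≠ 0 := by positivity
      push_cast
      field_simp
    · have := hD1 r hr.1.le hr.2.le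
      linarith
  have i2 : ∫ r in ε..ρ, F r ≤ (A * ρ ^ 3 / 3) - (T ε + A * ε ^ 3 / 3) := by
    have e0 : A * ρ ^ 3 / 3 = T ρ + A * ρ ^ 3 / 3 := by
      simp [hT, hψ, div_self (pow_ne_zero 2 hρ0.ne')]
    rw [e0]
    refine intervalIntegral.integral_le_sub_of_hasDeriv_right_of_le
      (g := fun r => T r + A * r ^ 3 / 3)
      (g' := fun r => F r - D r + A * r ^ 2) (by linarith) (by fun_prop)
      (fun r hr => HasDerivAt.hasDerivWithinAt ?_) hFc.continuousOn.integrableOn_Icc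
      (fun r hr => ?_)
    · refine ((hTd r).add (((hasDerivAt_pow 3 r).const_mul A).div_const 3)).congr_deriv ?_
      push_cast
      ring
    · have := hD2 r (hε.trans hr.1).le
      linarith
  have i3 : ∫ r in ρ..1, F r = 0 := by
    refine (intervalIntegral.integral_congr (g := fun _ => (0 : ℝ)) fun r hr => ?_).trans (by simp)
    rw [uIcc_of_le hρ1.le] at hr
    have h1 : max (1 - r ^ 2 / ρ ^ 2) 0 = 0 := by
      refine max_eq_right (sub_nonpos.2 ?_)
      rw [le_div_iff₀ (by positivity), one_mul]
      exact pow_le_pow_left₀ hρ0.le hr.1 2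
    simp only [hF, hgd, hψ, hψ', h1]
    simp [hg, cutoffBubble, h1]
  have i4 := intervalIntegral.integral_add_adjacent_intervals
    (hFc.intervalIntegrable 0 ε) (hFc.intervalIntegrable ε ρ) (μ := volume)
  have i5 := intervalIntegral.integral_add_adjacent_intervals
    (hFc.intervalIntegrable 0 ρ) (hFc.intervalIntegrable ρ 1) (μ := volume)
  -- The factor 2^(k+5) in ρ is chosen so that the left side is exactly 2/3 of the right.
  have i6 : A * ρ ^ 3 / 3 < B * ε ^ (k + 3) / (k + 3) := by
    have e1 : A * ρ ^ 3 / 3 = 2 / 3 * (2 ^ (k + 2) * ε ^ (k + 1))⁻¹ := by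
      rw [hA, hρ]
      field_simp
      ring
    have e2 : B * ε ^ (k + 3) / (k + 3) = (2 ^ (k + 2) * ε ^ (k + 1))⁻¹ := by
      rw [hB]
      field_simp
      ring
    rw [e1, e2]
    have : 0 < (2 ^ (k + 2) * ε ^ (k + 1))⁻¹ := by positivity
    linarith
  linarith

end cutoffBubble

/-! ### The radial Morse index -/

theorem hasRadialMorseIndex_bubble {k : ℕ} {ε : ℝ} (hε : 0 < ε) (hε1 : 2 ^ (k + 5) * ε < 1) :
    HasRadialMorseIndex (bubbleNonlinearity k ε) (bubbleSolution k ε) (Metric.ball 0 1) 1 := by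
  have hε2 : ε < 1 := by
    have : (1 : ℝ) ≤ 2 ^ (k + 5) := one_le_pow₀ one_le_two
    nlinarith
  have hV : ∀ x ∈ Metric.ball (0 : EuclideanSpace ℝ (Fin (k + 3))) 1,
      deriv (bubbleNonlinearity k ε) (bubbleSolution k ε x) = bubblePotential k ε ‖x‖ := by
    intro x hx
    exact deriv_bubbleNonlinearity hε (by simpa using hx)
  have hvol : 0 < volume.real (Metric.ball (0 : EuclideanSpace ℝ (Fin (k + 3))) 1) :=
    ENNReal.toReal_pos (Metric.measure_ball_pos _ _ one_pos).ne' measure_ball_lt_top.ne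
  constructor
  · set ρ : ℝ := 2 ^ (k + 5) * ε with hρ
    have hρ0 : 0 < ρ := by positivity
    set φ : EuclideanSpace ℝ (Fin (k + 3)) → ℝ := fun x => cutoffBubble k ε ρ (‖x‖ ^ 2) with hφ
    have hφC : ContDiff ℝ 1 φ := contDiff_cutoffBubble hε
    have hrad : IsRadialOn φ univ := by
      intro x _ y _ hxy
      simp only [hφ, hxy]
    have hsupp : tsupport φ ⊆ Metric.closedBall 0 ρ := by
      refine closure_minimal (fun x hx => ?_) Metric.isClosed_closedBall
      by_contra hx2
      rw [mem_closedBall_zero_iff, not_le] at hx2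
      refine hx ?_
      have h1 : max (1 - ‖x‖ ^ 2 / ρ ^ 2) 0 = 0 := by
        refine max_eq_right (sub_nonpos.2 ?_)
        rw [le_div_iff₀ (by positivity), one_mul]
        exact pow_le_pow_left₀ hρ0.le hx2.le 2
      simp [hφ, cutoffBubble, h1]
    have hmem : φ ∈ radialTestFunctions (Metric.ball (0 : EuclideanSpace ℝ (Fin (k + 3))) 1) :=
      ⟨hφC, (isCompact_closedBall _ _).of_isClosed_subset (isClosed_tsupport _) hsupp,
        hsupp.trans (Metric.closedBall_subset_ball hε1), hrad⟩
    have hφ0 : φ ≠ 0 := by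
      intro h
      have h1 := congrFun h 0
      have h2 := bubble_pos (k := k) hε (le_refl 0)
      simp [hφ, cutoffBubble] at h1
      exact h2.ne' h1
    refine ⟨Submodule.span ℝ {φ}, ?_, inferInstance, finrank_span_singleton hφ0, ?_⟩
    · rw [Submodule.span_singleton_le_iff_mem]
      exact hmem
    · intro χ hχ hχ0
      have hχmem : χ ∈ radialTestFunctions (Metric.ball (0 : EuclideanSpace ℝ (Fin (k + 3))) 1) :=
        (Submodule.span_singleton_le_iff_mem _ _).2 hmem hχ
      obtain ⟨a, rfl⟩ := Submodule.mem_span_singleton.1 hχ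
      have ha : a ≠ 0 := by
        rintro rfl
        simp at hχ0
      have hprof : radialProfile φ = fun r => cutoffBubble k ε ρ (r ^ 2) := by
        ext r
        simp [radialProfile, hφ, norm_smul]
      have hneg := radialForm_cutoffBubble_neg hε hρ hε1 hprof
      have hprof2 : radialProfile (a • φ) = a • radialProfile φ := rfl
      rw [secondVariation_eq_radial hV hχmem.2.2.2 hχmem.1, hprof2]
      have hint : ∀ r : ℝ, r ^ (k + 2) * (deriv (a • radialProfile φ) r ^ 2 -
          bubblePotential k ε r * (a • radialProfile φ) r ^ 2) = a ^ 2 * (r ^ (k + 2) *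
          (deriv (radialProfile φ) r ^ 2 - bubblePotential k ε r * radialProfile φ r ^ 2)) := by
        intro r
        rw [deriv_const_smul a (hφC.radialProfile.differentiable one_ne_zero r)]
        simp only [Pi.smul_apply, smul_eq_mul]
        ring
      simp only [hint]
      rw [intervalIntegral.integral_const_mul]
      have ha2 : 0 < a ^ 2 := by positivity
      exact mul_neg_of_pos_of_neg (by positivity) (mul_neg_of_pos_of_neg ha2 hneg)
  · rintro m ⟨X, hX, hfin, rfl, hneg⟩
    by_contra! hlt
    let ev : X →ₗ[ℝ] ℝ :=
      { toFun := fun φ => radialProfile φ.1 ε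
        map_add' := fun _ _ => rfl
        map_smul' := fun _ _ => rfl }
    -- In dimension at least 2, evaluation at radius ε kills a nonzero element, on which the form is
    -- both negative and nonnegative.
    have hker : LinearMap.ker ev ≠ ⊥ := ev.ker_ne_bot_of_finrank_lt (by simpa using hlt)
    obtain ⟨φ, hφker, hφ0⟩ := Submodule.exists_mem_ne_zero_of_ne_bot hker
    have hφX := hX φ.2
    have hφε : radialProfile φ.1 ε = 0 := hφker
    have hφ1 : radialProfile φ.1 1 = 0 := by
      refine image_eq_zero_of_notMem_tsupport (f := φ.1) fun h => ?_
      have := hφX.2.2.1 h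
      simp at this
    have h1 := hneg φ.1 φ.2 (fun h => hφ0 (Subtype.ext h))
    rw [secondVariation_eq_radial hV hφX.2.2.2 hφX.1] at h1
    have h2 := radialForm_nonneg_of_eq_zero (k := k) hε hε2 hφX.1.radialProfile hφε hφ1
    exact absurd h1 (not_lt.2 (mul_nonneg (by positivity) h2))

/-! ### Growth of the norms as ε → 0 -/

theorem memLp_norm_rpow_neg_ball {k : ℕ} {s : ℝ} {q : ℝ≥0∞} (hq0 : q ≠ 0) (hq : q ≠ ⊤)
    (hs : s * q.toReal < (k : ℝ) + 3) :
    MemLp (fun x : EuclideanSpace ℝ (Fin (k + 3)) => ‖x‖ ^ (-s)) q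
      (volume.restrict (Metric.ball (0 : EuclideanSpace ℝ (Fin (k + 3))) 1)) := by
  have hm : AEStronglyMeasurable (fun x : EuclideanSpace ℝ (Fin (k + 3)) => ‖x‖ ^ (-s))
      (volume.restrict (Metric.ball (0 : EuclideanSpace ℝ (Fin (k + 3))) 1)) :=
    (measurable_norm.pow_const _).aestronglyMeasurable
  rw [← integrable_norm_rpow_iff hm hq0 hq]
  have h1 : ∀ x : EuclideanSpace ℝ (Fin (k + 3)),
      ‖‖x‖ ^ (-s)‖ ^ q.toReal = (fun r : ℝ => r ^ (-(s * q.toReal))) ‖x‖ := by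
    intro x
    rw [Real.norm_of_nonneg (by positivity), ← Real.rpow_mul (norm_nonneg x), neg_mul]
  simp only [h1]
  refine (integrableOn_fun_norm_addHaar volume (f := fun r : ℝ => r ^ (-(s * q.toReal)))).2 ?_
  rw [finrank_euclideanSpace, Fintype.card_fin]
  have h2 : IntegrableOn (fun r : ℝ => r ^ ((k : ℝ) + 2 - s * q.toReal)) (Ioo 0 1) :=
    (intervalIntegral.integrableOn_Ioo_rpow_iff one_pos).2 (by linarith)
  refine h2.congr_fun (fun r hr => ?_) measurableSet_Ioo
  simp only [smul_eq_mul]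
  rw [← Real.rpow_natCast, ← Real.rpow_add hr.1]
  congr 1
  push_cast [Nat.add_sub_assoc]
  ring

section norms

variable {k : ℕ} {ε : ℝ}

/-- Split the power of ε² + r² in two, bounding the base below by ε² in one factor and by r² in the
other. The free exponent b later handles every q at once, with no case split at N/(N-2). -/
theorem bubble_le_rpow {b : ℝ} (hε : 0 < ε) (hb0 : 0 ≤ b) (hb : b ≤ (k : ℝ) + 1) {r : ℝ}
    (hr : 0 < r) : bubble k ε (r ^ 2) ≤ ε ^ (-b) * r ^ (-((k : ℝ) + 1 - b)) := by
  have h0 : 0 < ε ^ 2 + r ^ 2 := by positivity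
  have h1 : (ε ^ 2 + r ^ 2) ^ (-(b / 2)) ≤ ε ^ (-b) := by
    calc (ε ^ 2 + r ^ 2) ^ (-(b / 2)) ≤ (ε ^ 2) ^ (-(b / 2)) :=
          Real.rpow_le_rpow_of_nonpos (by positivity) (by nlinarith) (by linarith)
      _ = ε ^ (-b) := by
          rw [← Real.rpow_natCast, ← Real.rpow_mul hε.le]
          congr 1
          push_cast
          ring
  have h2 : (ε ^ 2 + r ^ 2) ^ (-(((k : ℝ) + 1 - b) / 2)) ≤ r ^ (-((k : ℝ) + 1 - b)) := by
    calc (ε ^ 2 + r ^ 2) ^ (-(((k : ℝ) + 1 - b) / 2)) ≤ (r ^ 2) ^ (-(((k : ℝ) + 1 - b) / 2)) :=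
          Real.rpow_le_rpow_of_nonpos (by positivity) (by nlinarith) (by linarith)
      _ = r ^ (-((k : ℝ) + 1 - b)) := by
          rw [← Real.rpow_natCast, ← Real.rpow_mul hr.le]
          congr 1
          push_cast
          ring
  calc bubble k ε (r ^ 2)
      = (ε ^ 2 + r ^ 2) ^ (-(b / 2)) * (ε ^ 2 + r ^ 2) ^ (-(((k : ℝ) + 1 - b) / 2)) := by
        rw [bubble, ← Real.rpow_add h0]
        congr 1
        ring
    _ ≤ _ := mul_le_mul h1 h2 (by positivity) (by positivity)

theorem bubbleSolution_nonneg (hε : 0 < ε) {x : EuclideanSpace ℝ (Fin (k + 3))} (hx : ‖x‖ ≤ 1) :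
    0 ≤ bubbleSolution k ε x :=
  sub_nonneg.2 (antitoneOn_bubble hε (sq_nonneg ‖x‖) (mem_Ici.2 zero_le_one)
    (pow_le_one₀ (norm_nonneg x) hx))

theorem memLp_bubbleSolution (hε : 0 < ε) (p : ℝ≥0∞) :
    MemLp (bubbleSolution k ε) p
      (volume.restrict (Metric.ball (0 : EuclideanSpace ℝ (Fin (k + 3))) 1)) := by
  have hc : Continuous (bubbleSolution k ε) := (contDiff_bubble_norm_sq hε _ (n := 0)).continuous
  have : IsFiniteMeasure
      (volume.restrict (Metric.ball (0 : EuclideanSpace ℝ (Fin (k + 3))) 1)) :=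
    isFiniteMeasure_restrict.2 measure_ball_lt_top.ne
  refine MemLp.of_bound hc.aestronglyMeasurable (bubble k ε 0) ?_
  filter_upwards [ae_restrict_mem measurableSet_ball] with x hx
  have hx1 : ‖x‖ ≤ 1 := (mem_ball_zero_iff.1 hx).le
  rw [Real.norm_of_nonneg (bubbleSolution_nonneg hε hx1)]
  have h1 : bubble k ε (‖x‖ ^ 2) ≤ bubble k ε 0 :=
    antitoneOn_bubble hε (mem_Ici.2 le_rfl) (sq_nonneg ‖x‖) (sq_nonneg ‖x‖)
  have h2 := bubble_pos (k := k) hε zero_le_one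
  rw [bubbleSolution]
  linarith

theorem exists_ballNorm_bubbleSolution_le {q : ℝ≥0∞} (hq0 : q ≠ 0) (hq : q ≠ ⊤) {b : ℝ}
    (hb0 : 0 ≤ b) (hb : b ≤ (k : ℝ) + 1) (hbq : ((k : ℝ) + 1 - b) * q.toReal < (k : ℝ) + 3) :
    ∃ C : ℝ, ∀ ε : ℝ, 0 < ε → ballNorm (bubbleSolution k ε) q ≤ C * ε ^ (-b) := by
  have hL := memLp_norm_rpow_neg_ball (k := k) hq0 hq hbq
  refine ⟨ballNorm (fun x : EuclideanSpace ℝ (Fin (k + 3)) => ‖x‖ ^ (-((k : ℝ) + 1 - b))) q,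
    fun ε hε => ?_⟩
  have h1 : eLpNorm (bubbleSolution k ε) q
      (volume.restrict (Metric.ball (0 : EuclideanSpace ℝ (Fin (k + 3))) 1)) ≤
      ENNReal.ofReal (ε ^ (-b)) * eLpNorm (fun x : EuclideanSpace ℝ (Fin (k + 3)) =>
        ‖x‖ ^ (-((k : ℝ) + 1 - b))) q
        (volume.restrict (Metric.ball (0 : EuclideanSpace ℝ (Fin (k + 3))) 1)) := by
    refine eLpNorm_le_mul_eLpNorm_of_ae_le_mul ?_ q
    have h0 : ∀ᵐ x : EuclideanSpace ℝ (Fin (k + 3)), x ≠ 0 := by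
      simp [ae_iff]
    filter_upwards [ae_restrict_mem measurableSet_ball, ae_restrict_of_ae h0] with x hx hx0
    have hx1 : ‖x‖ ≤ 1 := (mem_ball_zero_iff.1 hx).le
    rw [Real.norm_of_nonneg (bubbleSolution_nonneg hε hx1), Real.norm_of_nonneg (by positivity)]
    refine le_trans ?_ (bubble_le_rpow hε hb0 hb (norm_pos_iff.2 hx0))
    have h2 := bubble_pos (k := k) hε zero_le_one
    rw [bubbleSolution]
    linarith
  have h2 := ENNReal.toReal_mono (ENNReal.mul_ne_top ENNReal.ofReal_ne_top hL.2.ne) h1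
  rw [ENNReal.toReal_mul, ENNReal.toReal_ofReal (by positivity)] at h2
  rw [mul_comm]
  exact h2

/-- On the ball of radius ε the solution is at least dε^(-(N-2)). For p = ∞ the conventions
`⊤.toReal = 0` and x/0 = 0 give the correct exponent N-2. -/
theorem exists_le_ballNorm_bubbleSolution (k : ℕ) {p : ℝ≥0∞} (hp : p ≠ 0) :
    ∃ c : ℝ, 0 < c ∧ ∀ ε : ℝ, 0 < ε → ε ≤ 1 / 4 →
      c * ε ^ (-((k : ℝ) + 1 - ((k : ℝ) + 3) / p.toReal)) ≤ ballNorm (bubbleSolution k ε) p := by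
  set β : ℝ := volume.real (Metric.ball (0 : EuclideanSpace ℝ (Fin (k + 3))) 1) with hβ
  have hβ0 : 0 < β :=
    ENNReal.toReal_pos (Metric.measure_ball_pos _ _ one_pos).ne' measure_ball_lt_top.ne
  -- The 2 comes from ε² + |x|² ≤ 2ε² on the small ball, the 16 from ε² + 1 ≥ 16ε² when ε ≤ 1/4.
  set d : ℝ := (2 : ℝ) ^ (-(((k : ℝ) + 1) / 2)) - (16 : ℝ) ^ (-(((k : ℝ) + 1) / 2)) with hd
  have hk : (0 : ℝ) ≤ k := k.cast_nonneg
  have hd0 : 0 < d := sub_pos.2 (Real.rpow_lt_rpow_of_neg two_pos (by norm_num) (by linarith))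
  refine ⟨d * β ^ (1 / p.toReal), by positivity, fun ε hε hε4 => ?_⟩
  have hpt : ∀ x ∈ Metric.ball (0 : EuclideanSpace ℝ (Fin (k + 3))) ε,
      d * ε ^ (-((k : ℝ) + 1)) ≤ bubbleSolution k ε x := by
    intro x hx
    have hx1 : ‖x‖ < ε := mem_ball_zero_iff.1 hx
    have hxs : ‖x‖ ^ 2 ≤ ε ^ 2 := pow_le_pow_left₀ (norm_nonneg x) hx1.le 2
    have hpow : ∀ a : ℝ, 0 < a → a ^ (-(((k : ℝ) + 1) / 2)) * ε ^ (-((k : ℝ) + 1))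
        = (a * ε ^ 2) ^ (-(((k : ℝ) + 1) / 2)) := by
      intro a ha
      rw [Real.mul_rpow ha.le (sq_nonneg ε), ← Real.rpow_natCast ε 2, ← Real.rpow_mul hε.le]
      congr 2
      push_cast
      ring
    have h1 : (2 * ε ^ 2) ^ (-(((k : ℝ) + 1) / 2)) ≤ bubble k ε (‖x‖ ^ 2) :=
      Real.rpow_le_rpow_of_nonpos (by positivity) (by linarith) (by linarith)
    have h2 : bubble k ε 1 ≤ (16 * ε ^ 2) ^ (-(((k : ℝ) + 1) / 2)) :=
      Real.rpow_le_rpow_of_nonpos (by positivity) (by nlinarith) (by linarith)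
    rw [hd, sub_mul, hpow 2 two_pos, hpow 16 (by norm_num), bubbleSolution]
    linarith
  set s : Set (EuclideanSpace ℝ (Fin (k + 3))) := Metric.ball 0 ε with hs
  have hsub : s ⊆ Metric.ball 0 1 := Metric.ball_subset_ball (by linarith)
  have hμs : (volume.restrict (Metric.ball (0 : EuclideanSpace ℝ (Fin (k + 3))) 1)) s
      = volume s := Measure.restrict_eq_self _ hsub
  have hlow : eLpNorm (s.indicator fun _ => d * ε ^ (-((k : ℝ) + 1))) p
      (volume.restrict (Metric.ball (0 : EuclideanSpace ℝ (Fin (k + 3))) 1)) ≤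
      eLpNorm (bubbleSolution k ε) p
      (volume.restrict (Metric.ball (0 : EuclideanSpace ℝ (Fin (k + 3))) 1)) := by
    refine eLpNorm_mono_ae ?_
    filter_upwards [ae_restrict_mem measurableSet_ball] with x hx
    by_cases hxs : x ∈ s
    · rw [indicator_of_mem hxs, Real.norm_of_nonneg (by positivity)]
      exact (hpt x hxs).trans (le_abs_self _)
    · rw [indicator_of_notMem hxs, norm_zero]
      exact norm_nonneg _
  rw [eLpNorm_indicator_const' measurableSet_ball (by
    rw [hμs]; exact (Metric.measure_ball_pos _ _ hε).ne') hp, hμs] at hlow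
  have h3 := ENNReal.toReal_mono (memLp_bubbleSolution hε p).2.ne hlow
  refine le_of_eq_of_le ?_ h3
  have hvol : (volume s).toReal = ε ^ (k + 3) * β := by
    rw [hs, Measure.addHaar_ball _ _ hε.le, ENNReal.toReal_mul, finrank_euclideanSpace,
      Fintype.card_fin, ENNReal.toReal_ofReal (by positivity)]
    rfl
  rw [ENNReal.toReal_mul, ← ENNReal.toReal_rpow, hvol, toReal_enorm,
    Real.norm_of_nonneg (by positivity), Real.mul_rpow (by positivity) hβ0.le,
    ← Real.rpow_natCast, ← Real.rpow_mul hε.le, neg_sub, sub_eq_add_neg, Real.rpow_add hε]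
  push_cast
  rw [mul_one_div]
  ring

theorem ballNorm_bubbleSolution_pos (hε : 0 < ε) (hε1 : ε ≤ 1 / 4) {p : ℝ≥0∞} (hp : p ≠ 0) :
    0 < ballNorm (bubbleSolution k ε) p := by
  obtain ⟨c, hc, h⟩ := exists_le_ballNorm_bubbleSolution k hp
  exact lt_of_lt_of_le (by positivity) (h ε hε hε1)

theorem tendsto_ballNorm_bubbleSolution_ratio {p q : ℝ≥0∞} (hq : 1 ≤ q) (hqp : q < p)
    (hp : ENNReal.ofReal (((k : ℝ) + 3) / (k + 1)) < p) :
    Tendsto (fun ε => ballNorm (bubbleSolution k ε) p / ballNorm (bubbleSolution k ε) q)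
      (𝓝[>] 0) atTop := by
  have hq0 : q ≠ 0 := (one_pos.trans_le hq).ne'
  have hqt : q ≠ ⊤ := hqp.ne_top
  have hqr : 0 < q.toReal := ENNReal.toReal_pos hq0 hqt
  have hk : (0 : ℝ) < (k : ℝ) + 1 := by positivity
  set a : ℝ := (k : ℝ) + 1 - ((k : ℝ) + 3) / p.toReal with ha
  have ha1 : a ≤ (k : ℝ) + 1 := sub_le_self _ (by positivity)
  have ha2 : 0 < a ∧ (k : ℝ) + 1 - ((k : ℝ) + 3) / q.toReal < a := by
    rcases eq_or_ne p ⊤ with rfl | hpt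
    · have : 0 < ((k : ℝ) + 3) / q.toReal := by positivity
      simp only [ENNReal.toReal_top, div_zero, sub_zero] at ha
      constructor <;> linarith
    · have h1 : ((k : ℝ) + 3) / (k + 1) < p.toReal :=
        (ENNReal.ofReal_lt_iff_lt_toReal (by positivity) hpt).1 hp
      have h2 : q.toReal < p.toReal := ENNReal.toReal_strict_mono hpt hqp
      have h3 : 0 < p.toReal := hqr.trans h2
      constructor
      · rw [div_lt_iff₀ hk] at h1
        rw [ha, sub_pos, div_lt_iff₀ h3]
        linarith
      · rw [ha]
        gcongr
  -- The lower bound on b makes |x|^(-(N-2-b)) lie in L^q; b < a makes ε^(b-a) blow up.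
  obtain ⟨b, hb1, hb2⟩ := exists_between (max_lt ha2.1 ha2.2)
  have hb0 : 0 < b := (le_max_left _ _).trans_lt hb1
  have hbq : ((k : ℝ) + 1 - b) * q.toReal < (k : ℝ) + 3 := by
    have := (le_max_right _ _).trans_lt hb1
    rw [← lt_div_iff₀ hqr]
    linarith
  obtain ⟨c, hc, hlow⟩ := exists_le_ballNorm_bubbleSolution k (hq0.bot_lt.trans hqp).ne'
  obtain ⟨C, hup⟩ := exists_ballNorm_bubbleSolution_le hq0 hqt hb0.le (hb2.le.trans ha1) hbq
  have hC : 0 < C := by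
    have h1 := (ballNorm_bubbleSolution_pos (k := k) (ε := 1 / 4) (by norm_num) le_rfl hq0).trans_le
      (hup (1 / 4) (by norm_num))
    exact pos_of_mul_pos_left h1 (by positivity)
  have hlim : Tendsto (fun ε : ℝ => c / C * ε ^ (b - a)) (𝓝[>] 0) atTop :=
    (tendsto_rpow_neg_nhdsGT_zero (by linarith)).const_mul_atTop (by positivity)
  refine tendsto_atTop_mono' _ ?_ hlim
  filter_upwards [Ioc_mem_nhdsGT (show (0 : ℝ) < 1 / 4 by norm_num)] with ε hε
  rw [le_div_iff₀ (ballNorm_bubbleSolution_pos hε.1 hε.2 hq0)]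
  calc c / C * ε ^ (b - a) * ballNorm (bubbleSolution k ε) q
      ≤ c / C * ε ^ (b - a) * (C * ε ^ (-b)) := by
        have := hε.1
        gcongr
        exact hup ε this
    _ = c * ε ^ (-a) := by
        rw [sub_eq_add_neg, Real.rpow_add hε.1, Real.rpow_neg hε.1.le b]
        have := Real.rpow_pos_of_pos hε.1 b
        field_simp
    _ ≤ _ := hlow ε hε.1 hε.2

end norms

/-! ### The sequence ε_n → 0 -/

theorem theorem3p1 (N : ℕ) (hN3 : 3 ≤ N) (hN9 : N ≤ 9) (p q : ℝ≥0∞) (hq : 1 ≤ q) (hqp : q < p)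
    (hp : ENNReal.ofReal ((N : ℝ) / ((N : ℝ) - 2)) < p) :
    ∃ (u : ℕ → EuclideanSpace ℝ (Fin N) → ℝ) (f : ℕ → ℝ → ℝ),
      (∀ n, ContDiff ℝ ∞ (f n) ∧ (∀ s, 0 ≤ f n s) ∧ (∀ s, 0 ≤ deriv (f n) s) ∧
        IsSmoothDirichletSolution (f n) (u n) ∧
        IsRadialOn (u n) (Metric.closedBall 0 1) ∧
        HasRadialMorseIndex (f n) (u n) (Metric.ball 0 1) 1) ∧
      Tendsto (fun n => ballNorm (u n) p / ballNorm (u n) q) atTop atTop := by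
  obtain ⟨k, rfl⟩ := Nat.exists_eq_add_of_le' hN3
  have hp' : ENNReal.ofReal (((k : ℝ) + 3) / (k + 1)) < p := by
    convert hp using 3 <;> push_cast <;> ring
  -- The first factor keeps the cutoff radius 2^(k+5) ε_n below 1, so the test function has compact
  -- support in the ball.
  set ε : ℕ → ℝ := fun n => (2 ^ (k + 5))⁻¹ * (1 / ((n : ℝ) + 2)) with hε
  have hε0 : ∀ n, 0 < ε n := fun n => by positivity
  have hε1 : ∀ n, 2 ^ (k + 5) * ε n < 1 := by
    intro n
    rw [hε, mul_inv_cancel_left₀ (by positivity), div_lt_one (by positivity)]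
    have : (0 : ℝ) ≤ n := n.cast_nonneg
    linarith
  have hlim : Tendsto ε atTop (𝓝[>] 0) := by
    refine tendsto_nhdsWithin_iff.2 ⟨?_, Eventually.of_forall hε0⟩
    have h1 : Tendsto (fun n : ℕ => 1 / ((n : ℝ) + 2)) atTop (𝓝 0) :=
      tendsto_const_nhds.div_atTop
        (tendsto_atTop_add_const_right _ _ tendsto_natCast_atTop_atTop)
    simpa [hε] using h1.const_mul (((2 : ℝ) ^ (k + 5))⁻¹)
  refine ⟨fun n => bubbleSolution k (ε n), fun n => bubbleNonlinearity k (ε n), fun n => ?_,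
    (tendsto_ballNorm_bubbleSolution_ratio hq hqp hp').comp hlim⟩
  have hc := bubble_pos (k := k) (hε0 n) zero_le_one
  refine ⟨contDiff_shiftedPower hc, fun s => shiftedPower_nonneg (by positivity) hc,
    fun s => deriv_shiftedPower_nonneg (by positivity) hc (by positivity),
    isSmoothDirichletSolution_bubble (hε0 n), fun x _ y _ hxy => ?_,
    hasRadialMorseIndex_bubble (hε0 n) (hε1 n)⟩
  simp only [bubbleSolution, hxy]
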